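/- For complex $x,q$ with $|q|<1$ write $(x;q)_n=\prod_{j=0}^{n-1}(1-xq^j)$ for $n\ge 0$ (so $(x;q)_0=1$), $(x;q)_\infty=\prod_{j\ge0}(1-xq^j)$, and $(x_1,\dots,x_m;q)_n=(x_1;q)_n\cdots(x_m;q)_n$ for $0\le n\le\infty$. Let $a,b,c,d,q$ be complex numbers with $0<|q|<1$ and $a,c,d\neq0$, such that no denominator below vanishes, i.e. none of $a$, $b$, $cq/a$, $dq/a$, $cdq/a$ is of the form $q^{-m}$ with $m\in\{0,1,2,\dots\}$. Then all the series below converge absolutely (in the double sum: the inner series for each $n$, and the outer series), and $$ \begin{aligned} \sum_{n=0}^\infty \frac{(c,d;q)_n(abq^{n-1};q)_n\,q^n}{(q,a,b;q)_n} &=\frac{(q/a,cdq/a;q)_\infty}{(cq/a,dq/a;q)_\infty} \sum_{n=0}^\infty \frac{(c,d,cq/a,dq/a;q)_n\,b^nq^{n^2}}{(q,b;q)_n(cdq/a;q)_{2n}}\\ &\quad+\frac{q}{a}\,\frac{(c,d;q)_\infty}{(q,a;q)_\infty} \sum_{n=0}^\infty \frac{b^nq^{n^2}}{(q,b;q)_n}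 \sum_{k=0}^\infty \frac{(q^{1-n}/c,q^{1-n}/d;q)_k\,q^{k^2+2nk+2k}(1-q^{2k+2}/a)}{(cq^{n+1}/a,dq^{n+1}/a;q)_{k+1}}\Big(\frac{cd}{a^2}\Big)^k . \end{aligned} $$ -/

import Mathlib

/-- The finite `q`-shifted factorial `(a;q)_n = (1 - a)(1 - a q) ⋯ (1 - a q^(n-1))`,
with `(a;q)_0 = 1`. -/
noncomputable def qPoch (a q : ℂ) (n : ℕ) : ℂ :=
  ∏ j ∈ Finset.range n, (1 - a * q ^ j)

/-- The infinite `q`-shifted factorial `(a;q)_∞ = ∏_{n ≥ 0} (1 - a q^n)`,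
a convergent product when `‖q‖ < 1`. -/
noncomputable def qPochInf (a q : ℂ) : ℂ :=
  ∏' j : ℕ, (1 - a * q ^ j)

/-- The product defining `(a;q)_∞` converges for `‖q‖ < 1`. -/
theorem multipliable_qPochInf (a q : ℂ) (hq : ‖q‖ < 1) :
    Multipliable (fun j : ℕ => 1 - a * q ^ j) := by
  have h : Summable (fun j : ℕ => ‖-(a * q ^ j)‖) := by
    simpa [norm_mul, norm_pow] using
      (summable_geometric_of_lt_one (norm_nonneg q) hq).mul_left ‖a‖
  simpa [sub_eq_add_neg] using multipliable_one_add_of_summable h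

/-- The summand `(c,d;q)_n (a b q^(n-1);q)_n q^n / (q,a,b;q)_n` of the left-hand side. -/
noncomputable def lhsTerm (a b c d q : ℂ) (n : ℕ) : ℂ :=
  qPoch c q n * qPoch d q n * qPoch (a * b * q ^ ((n : ℤ) - 1)) q n * q ^ n /
    (qPoch q q n * qPoch a q n * qPoch b q n)

/-- The summand `(c,d,cq/a,dq/a;q)_n b^n q^(n^2) / ((q,b;q)_n (cdq/a;q)_{2n})` of the first
series on the right-hand side. -/
noncomputable def firstTerm (a b c d q : ℂ) (n : ℕ) : ℂ :=
  qPoch c q n * qPoch d q n * qPoch (c * q / a) q n * qPoch (d * q / a) q n *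
      b ^ n * q ^ (n ^ 2) /
    (qPoch q q n * qPoch b q n * qPoch (c * d * q / a) q (2 * n))

/-- The summand, indexed by `k`, of the inner series in the double sum:
`(q^(1-n)/c, q^(1-n)/d;q)_k q^(k^2+2nk+2k) (1 - q^(2k+2)/a) (cd/a^2)^k /
(cq^(n+1)/a, dq^(n+1)/a;q)_{k+1}`. -/
noncomputable def innerTerm (a c d q : ℂ) (n k : ℕ) : ℂ :=
  qPoch (q ^ (1 - (n : ℤ)) / c) q k * qPoch (q ^ (1 - (n : ℤ)) / d) q k *
      q ^ (k ^ 2 + 2 * n * k + 2 * k) * (1 - q ^ (2 * k + 2) / a) /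
    (qPoch (c * q ^ (n + 1) / a) q (k + 1) * qPoch (d * q ^ (n + 1) / a) q (k + 1)) *
    (c * d / a ^ 2) ^ k

/-- The summand, indexed by `n`, of the outer series in the double sum. -/
noncomputable def outerTerm (a b c d q : ℂ) (n : ℕ) : ℂ :=
  b ^ n * q ^ (n ^ 2) / (qPoch q q n * qPoch b q n) * ∑' k : ℕ, innerTerm a c d q n k

/-! The finite `q`-Chu–Vandermonde sum `qPoch_mul_eq_sum`, taken at A = a q^(n-1), turns
(abq^(n-1);q)_n q^n / (q,a,b;q)_n into a convolution over k + m = n of b^k q^(k²) / (q,b;q)_k with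
q^m / (q,a;q)_m. Since (c;q)_(k+m) = (c;q)_k (cq^k;q)_m, the left-hand side becomes an absolutely
convergent double series whose sum over m is ₂φ₁(cq^k, dq^k; a; q, q).

That ₂φ₁ is evaluated by `tsum_phiTerm_eq` as an infinite product plus a multiple of the inner
series; substituting this for each k gives the two sums on the right. For the evaluation, a and c
are fixed and d varies. Let D(d) be the difference of the two sides times (dq/a;q)_∞; this factor
removes the poles in d, so that every d is admissible, in particular d = 1 and the points dq^N. Both
series satisfy first-order relations between d and dq, obtained by telescoping, and their
inhomogeneous parts cancel: D(d) = (1 - cdq/a) D(dq). Iterating and letting dq^N → 0 gives D(d) =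
(cdq/a;q)_∞ D(0). At d = 1 the ₂φ₁ reduces to 1 and D(1) = 0; as (cq/a;q)_∞ ≠ 0, D(0) = 0 and so D
vanishes identically. -/

open Filter Topology

/-! ### Algebra and limits of `q`-shifted factorials. -/

theorem qPoch_zero (x q : ℂ) : qPoch x q 0 = 1 := by simp [qPoch]

theorem qPoch_succ (x q : ℂ) (n : ℕ) :
    qPoch x q (n + 1) = qPoch x q n * (1 - x * q ^ n) := by
  simp [qPoch, Finset.prod_range_succ]

theorem qPoch_succ' (x q : ℂ) (n : ℕ) :
    qPoch x q (n + 1) = (1 - x) * qPoch (x * q) q n := by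
  simp only [qPoch, Finset.prod_range_succ', pow_zero, mul_one]
  rw [mul_comm]
  congr 1
  exact Finset.prod_congr rfl fun j _ => by ring

theorem qPoch_add (x q : ℂ) (m n : ℕ) :
    qPoch x q (m + n) = qPoch x q m * qPoch (x * q ^ m) q n := by
  simp only [qPoch, Finset.prod_range_add]
  congr 1
  exact Finset.prod_congr rfl fun j _ => by ring

theorem qPoch_ne_zero {x q : ℂ} (h : ∀ m : ℕ, x * q ^ m ≠ 1) (n : ℕ) : qPoch x q n ≠ 0 :=
  Finset.prod_ne_zero_iff.2 fun j _ => sub_ne_zero.2 (h j).symm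

theorem mul_pow_shift_ne_one {x q : ℂ} (h : ∀ m : ℕ, x * q ^ m ≠ 1) (n m : ℕ) :
    x * q ^ n * q ^ m ≠ 1 := by
  rw [mul_assoc, ← pow_add]
  exact h _

theorem self_mul_pow_ne_one {q : ℂ} (hq : ‖q‖ < 1) (m : ℕ) : q * q ^ m ≠ 1 := by
  intro h
  have h' := congrArg norm h
  rw [← pow_succ', norm_pow, norm_one] at h'
  exact (pow_lt_one₀ (norm_nonneg q) hq (Nat.succ_ne_zero m)).ne h'

theorem tendsto_qPoch (x : ℂ) {q : ℂ} (hq : ‖q‖ < 1) :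
    Tendsto (qPoch x q) atTop (𝓝 (qPochInf x q)) :=
  (multipliable_qPochInf x q hq).tendsto_prod_tprod_nat

theorem qPochInf_eq_qPoch_mul (x : ℂ) {q : ℂ} (hq : ‖q‖ < 1) (n : ℕ) :
    qPochInf x q = qPoch x q n * qPochInf (x * q ^ n) q := by
  refine tendsto_nhds_unique ((tendsto_add_atTop_iff_nat n).2 (tendsto_qPoch x hq)) ?_
  have h := (tendsto_qPoch (x * q ^ n) hq).const_mul (qPoch x q n)
  refine h.congr fun m => ?_
  rw [add_comm m n, qPoch_add]

theorem qPochInf_eq_one_sub_mul (x : ℂ) {q : ℂ} (hq : ‖q‖ < 1) :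
    qPochInf x q = (1 - x) * qPochInf (x * q) q := by
  simpa [qPoch] using qPochInf_eq_qPoch_mul x hq 1

theorem qPochInf_one {q : ℂ} (hq : ‖q‖ < 1) : qPochInf 1 q = 0 := by
  simp [qPochInf_eq_one_sub_mul 1 hq]

theorem qPochInf_ne_zero {x q : ℂ} (hq : ‖q‖ < 1) (h : ∀ m : ℕ, x * q ^ m ≠ 1) :
    qPochInf x q ≠ 0 := by
  have hs : Summable (fun j : ℕ => ‖-(x * q ^ j)‖) := by
    simpa [norm_mul, norm_pow] using
      (summable_geometric_of_lt_one (norm_nonneg q) hq).mul_left ‖x‖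
  have := tprod_one_add_ne_zero_of_summable (f := fun j : ℕ => -(x * q ^ j))
    (fun j => by rw [← sub_eq_add_neg]; exact sub_ne_zero.2 (h j).symm) hs
  simpa [qPochInf, sub_eq_add_neg] using this

/-! ### Uniform bounds for `q`-shifted factorials. -/

theorem norm_qPoch_sub_one_le (x : ℂ) {q : ℂ} (hq : ‖q‖ < 1) (n : ℕ) :
    ‖qPoch x q n - 1‖ ≤ Real.exp (‖x‖ * (1 - ‖q‖)⁻¹) - 1 := by
  have h := (Finset.range n).norm_prod_one_add_sub_one_le (fun j => -(x * q ^ j))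
  have hsum : ∑ j ∈ Finset.range n, ‖-(x * q ^ j)‖ ≤ ‖x‖ * (1 - ‖q‖)⁻¹ := by
    simp only [norm_neg, norm_mul, norm_pow, ← Finset.mul_sum]
    gcongr
    rw [← tsum_geometric_of_lt_one (norm_nonneg q) hq]
    exact (summable_geometric_of_lt_one (norm_nonneg q) hq).sum_le_tsum _
      fun _ _ => by positivity
  simp only [← sub_eq_add_neg] at h
  refine h.trans ?_
  gcongr

theorem norm_qPoch_le (x : ℂ) {q : ℂ} (hq : ‖q‖ < 1) (n : ℕ) :
    ‖qPoch x q n‖ ≤ Real.exp (‖x‖ * (1 - ‖q‖)⁻¹) := by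
  have h1 := norm_qPoch_sub_one_le x hq n
  have h2 := norm_add_le (qPoch x q n - 1) 1
  rw [sub_add_cancel, norm_one] at h2
  linarith

theorem norm_qPochInf_sub_one_le (x : ℂ) {q : ℂ} (hq : ‖q‖ < 1) :
    ‖qPochInf x q - 1‖ ≤ Real.exp (‖x‖ * (1 - ‖q‖)⁻¹) - 1 :=
  le_of_tendsto ((tendsto_qPoch x hq).sub_const 1).norm
    (Eventually.of_forall fun n => norm_qPoch_sub_one_le x hq n)

theorem norm_qPochInf_le (x : ℂ) {q : ℂ} (hq : ‖q‖ < 1) :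
    ‖qPochInf x q‖ ≤ Real.exp (‖x‖ * (1 - ‖q‖)⁻¹) :=
  le_of_tendsto (tendsto_qPoch x hq).norm
    (Eventually.of_forall fun n => norm_qPoch_le x hq n)

theorem norm_qPoch_le_of_norm_le {x q : ℂ} {R : ℝ} (hq : ‖q‖ < 1) (hx : ‖x‖ ≤ R) (n : ℕ) :
    ‖qPoch x q n‖ ≤ Real.exp (R * (1 - ‖q‖)⁻¹) := by
  have : 0 ≤ (1 - ‖q‖)⁻¹ := inv_nonneg.2 (by linarith)
  refine (norm_qPoch_le x hq n).trans ?_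
  gcongr

theorem norm_qPochInf_le_of_norm_le {x q : ℂ} {R : ℝ} (hq : ‖q‖ < 1) (hx : ‖x‖ ≤ R) :
    ‖qPochInf x q‖ ≤ Real.exp (R * (1 - ‖q‖)⁻¹) := by
  have : 0 ≤ (1 - ‖q‖)⁻¹ := inv_nonneg.2 (by linarith)
  refine (norm_qPochInf_le x hq).trans ?_
  gcongr

theorem tendsto_qPochInf_zero {q : ℂ} (hq : ‖q‖ < 1) :
    Tendsto (fun x => qPochInf x q) (𝓝 0) (𝓝 1) := by
  rw [tendsto_iff_norm_sub_tendsto_zero]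
  refine squeeze_zero (fun _ => norm_nonneg _) (fun x => norm_qPochInf_sub_one_le x hq) ?_
  have : Continuous fun x : ℂ => Real.exp (‖x‖ * (1 - ‖q‖)⁻¹) - 1 := by fun_prop
  simpa using this.tendsto 0

/-- The reciprocals converge, because the infinite product is nonzero, and a convergent sequence is
bounded. -/
theorem exists_norm_inv_qPoch_le {x q : ℂ} (hq : ‖q‖ < 1) (h : ∀ m : ℕ, x * q ^ m ≠ 1) :
    ∃ M : ℝ, 0 < M ∧ ∀ n, ‖(qPoch x q n)⁻¹‖ ≤ M := by
  have ht := (tendsto_qPoch x hq).inv₀ (qPochInf_ne_zero hq h)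
  obtain ⟨M, hM⟩ := (Metric.isBounded_range_of_tendsto _ ht).exists_norm_le
  exact ⟨max M 1, by positivity, fun n => (hM _ ⟨n, rfl⟩).trans (le_max_left _ _)⟩

theorem norm_mul_pow_le (x : ℂ) {q : ℂ} (hq : ‖q‖ < 1) (n : ℕ) : ‖x * q ^ n‖ ≤ ‖x‖ := by
  rw [norm_mul, norm_pow]
  exact mul_le_of_le_one_right (norm_nonneg _) (pow_le_one₀ (norm_nonneg _) hq.le)

theorem tendsto_mul_pow_zero (x : ℂ) {q : ℂ} (hq : ‖q‖ < 1) :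
    Tendsto (fun n : ℕ => x * q ^ n) atTop (𝓝 0) := by
  simpa using (tendsto_pow_atTop_nhds_zero_of_norm_lt_one hq).const_mul x

/-- The ratio of consecutive terms is K r^(2k+1), which tends to 0. Every series containing q^(k²)
is dominated by one of this kind. -/
theorem summable_pow_mul_pow_sq {K r : ℝ} (hK : 0 < K) (hr0 : 0 < r) (hr1 : r < 1) :
    Summable fun k : ℕ => K ^ k * r ^ (k ^ 2) := by
  refine summable_of_ratio_test_tendsto_lt_one (l := 0) zero_lt_one
    (Eventually.of_forall fun n => by positivity) ?_
  have h : Tendsto (fun n : ℕ => K * r * (r ^ 2) ^ n) atTop (𝓝 0) := by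
    simpa using (tendsto_pow_atTop_nhds_zero_of_lt_one (by positivity)
      (pow_lt_one₀ hr0.le hr1 two_ne_zero)).const_mul (K * r)
  refine h.congr fun n => ?_
  rw [Real.norm_of_nonneg (by positivity), Real.norm_of_nonneg (by positivity), eq_div_iff
    (by positivity)]
  ring

/-! ### Gaussian binomials and the finite convolution formula. -/

/-- The Gaussian binomial coefficient, defined by the `q`-Pascal recursion. -/
def gaussBinom (q : ℂ) : ℕ → ℕ → ℂ
  | _, 0 => 1
  | 0, _ + 1 => 0
  | n + 1, k + 1 => q ^ (k + 1) * gaussBinom q n (k + 1) + gaussBinom q n k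

theorem gaussBinom_zero_right (q : ℂ) (n : ℕ) : gaussBinom q n 0 = 1 := by
  cases n <;> rfl

theorem gaussBinom_succ_succ (q : ℂ) (n k : ℕ) :
    gaussBinom q (n + 1) (k + 1) = q ^ (k + 1) * gaussBinom q n (k + 1) + gaussBinom q n k :=
  rfl

theorem gaussBinom_eq_zero (q : ℂ) {n k : ℕ} (h : n < k) : gaussBinom q n k = 0 := by
  induction n generalizing k with
  | zero =>
    obtain ⟨k, rfl⟩ := Nat.exists_eq_succ_of_ne_zero h.ne'
    rfl
  | succ n ih =>
    obtain ⟨k, rfl⟩ := Nat.exists_eq_succ_of_ne_zero (Nat.ne_zero_of_lt h)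
    rw [Nat.succ_eq_add_one, gaussBinom_succ_succ, ih (by omega), ih (by omega)]
    ring

theorem gaussBinom_mul_qPoch (q : ℂ) (n k m : ℕ) (h : k + m = n) :
    gaussBinom q n k * (qPoch q q k * qPoch q q m) = qPoch q q n := by
  induction n generalizing k m with
  | zero =>
    obtain ⟨rfl, rfl⟩ : k = 0 ∧ m = 0 := by omega
    simp [gaussBinom_zero_right, qPoch_zero]
  | succ n ih =>
    rcases k with _ | k
    · obtain rfl : m = n + 1 := by omega
      simp [gaussBinom_zero_right, qPoch_zero]
    · rcases m with _ | m
      · obtain rfl : k = n := by omega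
        have := ih k 0 rfl
        rw [gaussBinom_succ_succ, gaussBinom_eq_zero q (Nat.lt_succ_self k), qPoch_succ]
        linear_combination (1 - q * q ^ k) * this
      · have h1 := ih (k + 1) m (by omega)
        have h2 := ih k (m + 1) (by omega)
        obtain rfl : n = k + m + 1 := by omega
        rw [gaussBinom_succ_succ, qPoch_succ q q (k + m + 1)]
        rw [qPoch_succ q q k] at h1 ⊢
        rw [qPoch_succ q q m] at h2 ⊢
        linear_combination (q ^ (k + 1) * (1 - q * q ^ m)) * h1 + (1 - q * q ^ k) * h2

/-- A finite `q`-Chu–Vandermonde sum. -/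
theorem qPoch_mul_eq_sum (A b q : ℂ) (n : ℕ) :
    qPoch (A * b) q n = ∑ k ∈ Finset.range (n + 1), gaussBinom q n k *
      (∏ j ∈ Finset.range k, b * q ^ j * (q ^ j - A)) * qPoch (b * q ^ k) q (n - k) := by
  induction n generalizing b with
  | zero => simp [gaussBinom_zero_right, qPoch_zero]
  | succ n ih =>
    -- The induction passes from b to bq. The extra factor is split as 1 - Ab = (1 - bq^k) + b(q^k -
    -- A): the first part lengthens the shifted factorial, the second the product over j.
    have key : ∀ k ∈ Finset.range (n + 1),
        (1 - A * b) * (gaussBinom q n k *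
          (∏ j ∈ Finset.range k, b * q * q ^ j * (q ^ j - A)) *
            qPoch (b * q * q ^ k) q (n - k)) =
        q ^ k * gaussBinom q n k * (∏ j ∈ Finset.range k, b * q ^ j * (q ^ j - A)) *
          qPoch (b * q ^ k) q (n + 1 - k) +
        gaussBinom q n k * (∏ j ∈ Finset.range (k + 1), b * q ^ j * (q ^ j - A)) *
          qPoch (b * q ^ (k + 1)) q (n - k) := by
      intro k hk
      have hk' : k ≤ n := by simpa [Nat.lt_succ_iff] using hk
      have hp : (∏ j ∈ Finset.range k, b * q * q ^ j * (q ^ j - A)) =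
          q ^ k * ∏ j ∈ Finset.range k, b * q ^ j * (q ^ j - A) := by
        conv_lhs => enter [2, j]; rw [show b * q * q ^ j * (q ^ j - A) =
          q * (b * q ^ j * (q ^ j - A)) by ring]
        rw [Finset.prod_mul_distrib, Finset.prod_const, Finset.card_range]
      rw [hp, Finset.prod_range_succ, Nat.succ_sub hk', Nat.succ_eq_add_one, qPoch_succ',
        show b * q ^ k * q = b * q ^ (k + 1) by ring, show b * q * q ^ k = b * q ^ (k + 1) by ring]
      ring
    rw [qPoch_succ', mul_assoc A b q, ih (b * q), Finset.mul_sum, Finset.sum_congr rfl key,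
      Finset.sum_add_distrib, Finset.sum_range_succ' _ (n + 1)]
    -- The term at k = n + 1 vanishes, so it can be added and the term at k = 0 split off. The
    -- shifted sum then pairs with the other one through the `q`-Pascal rule.
    have h0 : ∑ k ∈ Finset.range (n + 1), q ^ k * gaussBinom q n k *
          (∏ j ∈ Finset.range k, b * q ^ j * (q ^ j - A)) * qPoch (b * q ^ k) q (n + 1 - k) =
        ∑ k ∈ Finset.range (n + 1), q ^ (k + 1) * gaussBinom q n (k + 1) *
          (∏ j ∈ Finset.range (k + 1), b * q ^ j * (q ^ j - A)) *
            qPoch (b * q ^ (k + 1)) q (n - k) + qPoch b q (n + 1) := by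
      have h1 := Finset.sum_range_succ (fun k => q ^ k * gaussBinom q n k *
          (∏ j ∈ Finset.range k, b * q ^ j * (q ^ j - A)) * qPoch (b * q ^ k) q (n + 1 - k))
          (n + 1)
      have h2 := Finset.sum_range_succ' (fun k => q ^ k * gaussBinom q n k *
          (∏ j ∈ Finset.range k, b * q ^ j * (q ^ j - A)) * qPoch (b * q ^ k) q (n + 1 - k))
          (n + 1)
      rw [h1, gaussBinom_eq_zero q (Nat.lt_succ_self n)] at h2
      simpa [gaussBinom_zero_right] using h2
    rw [h0]
    simp only [gaussBinom_succ_succ, gaussBinom_zero_right, Nat.add_sub_add_right, add_mul,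
      Finset.sum_add_distrib]
    simp
    ring

/-- At A = x q^(k-1) the factors q^j - A are those of (x;q)_k in reverse order, up to powers of q.
The two families of powers and q^k multiply to q^(k(k-1)+k) = q^(k²). -/
theorem pow_mul_prod_eq_qPoch (b x : ℂ) {q : ℂ} (hq0 : q ≠ 0) (k : ℕ) :
    q ^ k * ∏ j ∈ Finset.range k, b * q ^ j * (q ^ j - x * q ^ ((k : ℤ) - 1)) =
      b ^ k * q ^ (k ^ 2) * qPoch x q k := by
  induction k generalizing x with
  | zero => simp [qPoch_zero]
  | succ k ih =>
    have h : x * q ^ (((k + 1 : ℕ) : ℤ) - 1) = x * q * q ^ ((k : ℤ) - 1) := by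
      rw [mul_assoc, ← zpow_one_add₀ hq0]
      congr 2
      push_cast
      ring
    have h' : x * q * q ^ ((k : ℤ) - 1) = x * q ^ k := by
      rw [mul_assoc, ← zpow_one_add₀ hq0, ← zpow_natCast]
      congr 2
      ring
    rw [h, Finset.prod_range_succ, qPoch_succ']
    have := ih (x * q)
    rw [h'] at this ⊢
    linear_combination (q * (b * q ^ k * (q ^ k - x * q ^ k))) * this

theorem qPoch_div_eq_sum_antidiagonal {a b q : ℂ} (hq0 : q ≠ 0) (hq : ‖q‖ < 1)
    (ha : ∀ m : ℕ, a * q ^ m ≠ 1) (hb : ∀ m : ℕ, b * q ^ m ≠ 1) (n : ℕ) :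
    qPoch (a * b * q ^ ((n : ℤ) - 1)) q n * q ^ n / (qPoch q q n * qPoch a q n * qPoch b q n) =
      ∑ p ∈ Finset.HasAntidiagonal.antidiagonal n, b ^ p.1 * q ^ (p.1 ^ 2) / (qPoch q q p.1 * qPoch b q p.1) *
        (q ^ p.2 / (qPoch q q p.2 * qPoch a q p.2)) := by
  rw [show a * b * q ^ ((n : ℤ) - 1) = a * q ^ ((n : ℤ) - 1) * b by ring, qPoch_mul_eq_sum,
    Finset.Nat.sum_antidiagonal_eq_sum_range_succ (fun k m => b ^ k * q ^ (k ^ 2) /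
      (qPoch q q k * qPoch b q k) * (q ^ m / (qPoch q q m * qPoch a q m))),
    Finset.sum_mul, Finset.sum_div]
  refine Finset.sum_congr rfl fun k hk => ?_
  obtain ⟨m, rfl⟩ := Nat.exists_eq_add_of_le (show k ≤ n by simpa [Nat.lt_succ_iff] using hk)
  have hg := gaussBinom_mul_qPoch q (k + m) k m rfl
  have hw := pow_mul_prod_eq_qPoch b (a * q ^ m) hq0 k
  have hz : a * q ^ m * q ^ ((k : ℤ) - 1) = a * q ^ (((k + m : ℕ) : ℤ) - 1) := by
    rw [mul_assoc, ← zpow_natCast q m, ← zpow_add₀ hq0]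
    congr 2
    push_cast
    ring
  rw [hz] at hw
  have hqn := self_mul_pow_ne_one hq
  have e1 := qPoch_ne_zero hqn k
  have e2 := qPoch_ne_zero hqn m
  have e3 := qPoch_ne_zero hb k
  have e4 := qPoch_ne_zero ha m
  have e5 := qPoch_ne_zero hqn (k + m)
  have e6 := qPoch_ne_zero (mul_pow_shift_ne_one hb k) m
  have e7 := qPoch_ne_zero (mul_pow_shift_ne_one ha m) k
  -- Rewriting with `← hg` puts the Gaussian binomial into a denominator.
  have e8 : gaussBinom q (k + m) k ≠ 0 := fun h => e5 (by rw [← hg, h, zero_mul])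
  rw [Nat.add_sub_cancel_left, qPoch_add b q k m, add_comm k m, qPoch_add a q m k, add_comm m k,
    ← hg, div_mul_div_comm, div_eq_div_iff (by simp [*]) (by simp [*]), pow_add]
  linear_combination (gaussBinom q (k + m) k * qPoch (b * q ^ k) q m * q ^ m * qPoch q q k *
    qPoch b q k * qPoch q q m * qPoch a q m) * hw

/-! ### The series ₂φ₁(c, d; a; q, q) and its contiguous relation in d. -/

/-- The summand of the `q`-hypergeometric series `₂φ₁(c, d; a; q, q)`. -/
noncomputable def phiTerm (a c d q : ℂ) (m : ℕ) : ℂ :=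
  qPoch c q m * qPoch d q m * (q ^ m / (qPoch q q m * qPoch a q m))

theorem exists_norm_pow_div_qPoch_le {a q : ℂ} (hq : ‖q‖ < 1) (ha : ∀ m : ℕ, a * q ^ m ≠ 1) :
    ∃ M : ℝ, 0 < M ∧ ∀ m, ‖q ^ m / (qPoch q q m * qPoch a q m)‖ ≤ M * ‖q‖ ^ m := by
  obtain ⟨M₁, hM₁, h₁⟩ := exists_norm_inv_qPoch_le hq (self_mul_pow_ne_one hq)
  obtain ⟨M₂, hM₂, h₂⟩ := exists_norm_inv_qPoch_le hq ha
  refine ⟨M₁ * M₂, by positivity, fun m => ?_⟩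
  rw [div_eq_mul_inv, mul_inv, norm_mul, norm_mul, norm_pow, mul_comm]
  gcongr
  exacts [h₁ m, h₂ m]

/-- The constant is uniform in c and d on a ball. This serves both the limit along dq^N and the
double series, whose parameters are cq^n and dq^n. -/
theorem exists_norm_phiTerm_le {a q : ℂ} (R : ℝ) (hq : ‖q‖ < 1) (ha : ∀ m : ℕ, a * q ^ m ≠ 1) :
    ∃ M : ℝ, 0 < M ∧ ∀ c d : ℂ, ‖c‖ ≤ R → ‖d‖ ≤ R → ∀ m,
      ‖phiTerm a c d q m‖ ≤ M * ‖q‖ ^ m := by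
  obtain ⟨M, hM, h⟩ := exists_norm_pow_div_qPoch_le hq ha
  refine ⟨Real.exp (R * (1 - ‖q‖)⁻¹) * Real.exp (R * (1 - ‖q‖)⁻¹) * M, by positivity,
    fun c d hc hd m => ?_⟩
  rw [phiTerm, norm_mul, norm_mul, mul_assoc _ M]
  gcongr
  exacts [norm_qPoch_le_of_norm_le hq hc m, norm_qPoch_le_of_norm_le hq hd m, h m]

theorem summable_phiTerm {a q : ℂ} (c d : ℂ) (hq : ‖q‖ < 1) (ha : ∀ m : ℕ, a * q ^ m ≠ 1) :
    Summable (phiTerm a c d q) := by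
  obtain ⟨M, -, h⟩ := exists_norm_phiTerm_le (max ‖c‖ ‖d‖) hq ha
  exact .of_norm_bounded ((summable_geometric_of_lt_one (norm_nonneg q) hq).mul_left M)
    (h c d (le_max_left _ _) (le_max_right _ _))

/-- The combination telescopes. Its boundary term does not tend to 0 in general: its limit is the
inhomogeneous part of `tsum_phiTerm_contiguous`. -/
theorem sum_range_phiTerm_contiguous {a c d q : ℂ} (ha0 : a ≠ 0) (hq : ‖q‖ < 1)
    (ha : ∀ m : ℕ, a * q ^ m ≠ 1) (N : ℕ) :
    ∑ m ∈ Finset.range (N + 1),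
      ((1 - d * q / a) * phiTerm a c d q m - (1 - c * d * q / a) * phiTerm a c (d * q) q m) =
    -(d * q / a) * (qPoch c q (N + 1) * qPoch (d * q) q N / (qPoch q q N * qPoch a q N)) := by
  induction N with
  | zero =>
    simp [phiTerm, qPoch_zero, qPoch_succ]
    ring
  | succ N ih =>
    have e1 := qPoch_ne_zero (self_mul_pow_ne_one hq) N
    have e2 := qPoch_ne_zero ha N
    have e3 : 1 - q * q ^ N ≠ 0 := sub_ne_zero.2 (self_mul_pow_ne_one hq N).symm
    have e4 : 1 - a * q ^ N ≠ 0 := sub_ne_zero.2 (ha N).symm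
    rw [Finset.sum_range_succ, ih, phiTerm, phiTerm, qPoch_succ c q (N + 1), qPoch_succ' d,
      qPoch_succ (d * q), qPoch_succ q, qPoch_succ a]
    field_simp
    ring

theorem tsum_phiTerm_contiguous {a c d q : ℂ} (ha0 : a ≠ 0) (hq : ‖q‖ < 1)
    (ha : ∀ m : ℕ, a * q ^ m ≠ 1) :
    (1 - d * q / a) * ∑' m, phiTerm a c d q m =
      (1 - c * d * q / a) * ∑' m, phiTerm a c (d * q) q m -
        d * q / a * (qPochInf c q * qPochInf (d * q) q / (qPochInf q q * qPochInf a q)) := by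
  have h1 := ((summable_phiTerm c d hq ha).hasSum.mul_left (1 - d * q / a)).sub
    ((summable_phiTerm c (d * q) hq ha).hasSum.mul_left (1 - c * d * q / a))
  have h2 := (tendsto_add_atTop_iff_nat 1).2 h1.tendsto_sum_nat
  have h3 := ((((tendsto_add_atTop_iff_nat 1).2 (tendsto_qPoch c hq)).mul
    (tendsto_qPoch (d * q) hq)).div ((tendsto_qPoch q hq).mul (tendsto_qPoch a hq))
    (mul_ne_zero (qPochInf_ne_zero hq (self_mul_pow_ne_one hq))
      (qPochInf_ne_zero hq ha))).const_mul (-(d * q / a))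
  have h4 := tendsto_nhds_unique h2
    (h3.congr fun N => (sum_range_phiTerm_contiguous ha0 hq ha N).symm)
  linear_combination h4

theorem tsum_phiTerm_one (a c q : ℂ) : ∑' m, phiTerm a c 1 q m = 1 := by
  rw [tsum_eq_single 0]
  · simp [phiTerm, qPoch_zero]
  · intro m hm
    obtain ⟨m, rfl⟩ := Nat.exists_eq_succ_of_ne_zero hm
    simp [phiTerm, qPoch_succ']

theorem continuous_qPoch (q : ℂ) (n : ℕ) : Continuous fun x => qPoch x q n := by
  unfold qPoch
  fun_prop

theorem tendsto_tsum_phiTerm {a q : ℂ} (c d : ℂ) (hq : ‖q‖ < 1) (ha : ∀ m : ℕ, a * q ^ m ≠ 1) :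
    Tendsto (fun N : ℕ => ∑' m, phiTerm a c (d * q ^ N) q m) atTop
      (𝓝 (∑' m, phiTerm a c 0 q m)) := by
  obtain ⟨M, -, h⟩ := exists_norm_phiTerm_le (max ‖c‖ ‖d‖) hq ha
  refine tendsto_tsum_of_dominated_convergence
    ((summable_geometric_of_lt_one (norm_nonneg q) hq).mul_left M) (fun m => ?_)
    (Eventually.of_forall fun N => h c _ (le_max_left _ _)
      ((norm_mul_pow_le d hq N).trans (le_max_right _ _)))
  have := ((continuous_qPoch q m).tendsto 0).comp (tendsto_mul_pow_zero d hq)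
  exact (this.const_mul (qPoch c q m)).mul_const _

/-! ### The inner series, regularised in d, and its contiguous relation. -/

/-- The polynomial `(x - q)(x - q²) ⋯ (x - q^k)`, equal to `x^k (q/x;q)_k` for `x ≠ 0`. -/
noncomputable def reversedPoch (x q : ℂ) (k : ℕ) : ℂ :=
  ∏ j ∈ Finset.range k, (x - q ^ (j + 1))

theorem pow_mul_qPoch_div {x : ℂ} (hx : x ≠ 0) (q : ℂ) (k : ℕ) :
    x ^ k * qPoch (q / x) q k = reversedPoch x q k := by
  rw [qPoch, reversedPoch, ← Finset.card_range k, ← Finset.prod_const, Finset.card_range,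
    ← Finset.prod_mul_distrib]
  refine Finset.prod_congr rfl fun j _ => ?_
  field_simp
  ring

theorem reversedPoch_succ (x q : ℂ) (k : ℕ) :
    reversedPoch x q (k + 1) = reversedPoch x q k * (x - q ^ (k + 1)) := by
  simp [reversedPoch, Finset.prod_range_succ]

theorem reversedPoch_mul (x q : ℂ) (k : ℕ) :
    reversedPoch (x * q) q k = q ^ k * ∏ j ∈ Finset.range k, (x - q ^ j) := by
  rw [reversedPoch, ← Finset.card_range k, ← Finset.prod_const, Finset.card_range,
    ← Finset.prod_mul_distrib]
  exact Finset.prod_congr rfl fun j _ => by ring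

/-- Both sides are the product of x - q^j over 0 ≤ j ≤ k. With `reversedPoch_mul` this exhibits the
common factor of the summands at d and at dq. -/
theorem sub_one_mul_reversedPoch (x q : ℂ) (k : ℕ) :
    (x - 1) * reversedPoch x q k = (∏ j ∈ Finset.range k, (x - q ^ j)) * (x - q ^ k) := by
  rw [← Finset.prod_range_succ, Finset.prod_range_succ', reversedPoch]
  ring

theorem norm_sub_pow_le {x q : ℂ} {R : ℝ} (hq : ‖q‖ < 1) (hx : ‖x‖ ≤ R) (j : ℕ) :
    ‖x - q ^ j‖ ≤ R + 1 := by
  refine (norm_sub_le _ _).trans ?_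
  rw [norm_pow]
  exact add_le_add hx (pow_le_one₀ (norm_nonneg _) hq.le)

theorem norm_reversedPoch_le {x q : ℂ} {R : ℝ} (hq : ‖q‖ < 1) (hx : ‖x‖ ≤ R) (k : ℕ) :
    ‖reversedPoch x q k‖ ≤ (R + 1) ^ k := by
  rw [reversedPoch, norm_prod]
  simpa using Finset.prod_le_prod (s := Finset.range k) (fun j _ => norm_nonneg (x - q ^ (j + 1)))
    fun j _ => norm_sub_pow_le hq hx (j + 1)

/-- The numerator of the inner series. -/
noncomputable def coreTerm (a c d q : ℂ) (k : ℕ) : ℂ :=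
  reversedPoch c q k * reversedPoch d q k * q ^ (k ^ 2 + 2 * k) * (1 - q ^ (2 * k + 2) / a) /
    a ^ (2 * k)

theorem norm_coreTerm_le {a c d q : ℂ} {R : ℝ} (hq : ‖q‖ < 1) (hc : ‖c‖ ≤ R) (hd : ‖d‖ ≤ R)
    (k : ℕ) :
    ‖coreTerm a c d q k‖ ≤ (1 + ‖a‖⁻¹) * (((R + 1) ^ 2 / ‖a‖ ^ 2) ^ k * ‖q‖ ^ (k ^ 2)) := by
  have hR : 0 ≤ R := (norm_nonneg c).trans hc
  have h1 : ‖1 - q ^ (2 * k + 2) / a‖ ≤ 1 + ‖a‖⁻¹ := by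
    refine (norm_sub_le _ _).trans ?_
    rw [norm_one, norm_div, norm_pow, div_eq_mul_inv]
    gcongr
    exact mul_le_of_le_one_left (by positivity) (pow_le_one₀ (norm_nonneg _) hq.le)
  have h2 : ‖q ^ (k ^ 2 + 2 * k)‖ ≤ ‖q‖ ^ (k ^ 2) := by
    rw [norm_pow]
    exact pow_le_pow_of_le_one (norm_nonneg _) hq.le (by omega)
  have h3 := norm_reversedPoch_le hq hc k
  have h4 := norm_reversedPoch_le hq hd k
  calc ‖coreTerm a c d q k‖
      = ‖reversedPoch c q k‖ * ‖reversedPoch d q k‖ * ‖q ^ (k ^ 2 + 2 * k)‖ *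
          ‖1 - q ^ (2 * k + 2) / a‖ / ‖a‖ ^ (2 * k) := by
        simp only [coreTerm, norm_mul, norm_div, norm_pow]
    _ ≤ (R + 1) ^ k * (R + 1) ^ k * ‖q‖ ^ (k ^ 2) * (1 + ‖a‖⁻¹) / ‖a‖ ^ (2 * k) := by gcongr
    _ = _ := by rw [div_pow, ← pow_mul, ← pow_mul]; ring

/-- The summand of the inner series, multiplied by `(dq/a;q)_∞`. -/
noncomputable def regTerm (a c d q : ℂ) (k : ℕ) : ℂ :=
  coreTerm a c d q k * (qPoch (c * q / a) q (k + 1))⁻¹ * qPochInf (d / a * q ^ (k + 2)) q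

theorem exists_norm_regTerm_le {a c q : ℂ} (R : ℝ) (hq : ‖q‖ < 1)
    (hca : ∀ m : ℕ, (c * q / a) * q ^ m ≠ 1) :
    ∃ M : ℝ, ∀ d : ℂ, ‖c‖ ≤ R → ‖d‖ ≤ R → ∀ k,
      ‖regTerm a c d q k‖ ≤ M * (((R + 1) ^ 2 / ‖a‖ ^ 2) ^ k * ‖q‖ ^ (k ^ 2)) := by
  obtain ⟨M, hM, h⟩ := exists_norm_inv_qPoch_le hq hca
  refine ⟨(1 + ‖a‖⁻¹) * M * Real.exp (R / ‖a‖ * (1 - ‖q‖)⁻¹), fun d hc hd k => ?_⟩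
  have h1 : ‖d / a‖ ≤ R / ‖a‖ := by rw [norm_div]; gcongr
  have h2 := norm_qPochInf_le_of_norm_le hq ((norm_mul_pow_le (d / a) hq (k + 2)).trans h1)
  have h3 := norm_coreTerm_le (a := a) hq hc hd k
  have h4 := h (k + 1)
  have hR : 0 ≤ R := (norm_nonneg c).trans hc
  calc ‖regTerm a c d q k‖ = ‖coreTerm a c d q k‖ * ‖(qPoch (c * q / a) q (k + 1))⁻¹‖ *
        ‖qPochInf (d / a * q ^ (k + 2)) q‖ := by simp only [regTerm, norm_mul]
    _ ≤ (1 + ‖a‖⁻¹) * (((R + 1) ^ 2 / ‖a‖ ^ 2) ^ k * ‖q‖ ^ (k ^ 2)) * M *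
        Real.exp (R / ‖a‖ * (1 - ‖q‖)⁻¹) := by gcongr
    _ = _ := by ring

theorem summable_dominating {a q : ℂ} {R : ℝ} (ha0 : a ≠ 0) (hq0 : q ≠ 0) (hq : ‖q‖ < 1)
    (hR : 0 ≤ R) :
    Summable fun k : ℕ => ((R + 1) ^ 2 / ‖a‖ ^ 2) ^ k * ‖q‖ ^ (k ^ 2) := by
  have := norm_pos_iff.2 ha0
  exact summable_pow_mul_pow_sq (by positivity) (norm_pos_iff.2 hq0) hq

theorem summable_regTerm {a c q : ℂ} (d : ℂ) (ha0 : a ≠ 0) (hq0 : q ≠ 0) (hq : ‖q‖ < 1)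
    (hca : ∀ m : ℕ, (c * q / a) * q ^ m ≠ 1) : Summable (regTerm a c d q) := by
  obtain ⟨M, h⟩ := exists_norm_regTerm_le (max ‖c‖ ‖d‖) hq hca
  exact .of_norm_bounded ((summable_dominating ha0 hq0 hq (by positivity)).mul_left M)
    (h d (le_max_left _ _) (le_max_right _ _))

theorem tendsto_tsum_regTerm {a c q : ℂ} (d : ℂ) (ha0 : a ≠ 0) (hq0 : q ≠ 0) (hq : ‖q‖ < 1)
    (hca : ∀ m : ℕ, (c * q / a) * q ^ m ≠ 1) :
    Tendsto (fun N : ℕ => ∑' k, regTerm a c (d * q ^ N) q k) atTop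
      (𝓝 (∑' k, regTerm a c 0 q k)) := by
  obtain ⟨M, h⟩ := exists_norm_regTerm_le (max ‖c‖ ‖d‖) hq hca
  refine tendsto_tsum_of_dominated_convergence
    ((summable_dominating ha0 hq0 hq (by positivity)).mul_left M) (fun k => ?_)
    (Eventually.of_forall fun N => h _ (le_max_left _ _)
      ((norm_mul_pow_le d hq N).trans (le_max_right _ _)))
  have h1 : Continuous fun x => coreTerm a c x q k := by
    unfold coreTerm reversedPoch
    fun_prop
  have h2 := (h1.tendsto 0).comp (tendsto_mul_pow_zero d hq)
  have h3 : Tendsto (fun N : ℕ => d * q ^ N / a * q ^ (k + 2)) atTop (𝓝 0) := by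
    simpa using ((tendsto_mul_pow_zero d hq).div_const a).mul_const (q ^ (k + 2))
  have h4 := (tendsto_qPochInf_zero hq).comp h3
  have h5 := (h2.mul_const (qPoch (c * q / a) q (k + 1))⁻¹).mul h4
  simpa [regTerm, qPochInf, Function.comp_def] using h5

/-- The antidifference of the contiguous relation for `regTerm`. -/
noncomputable def regTelescope (a c d q : ℂ) (k : ℕ) : ℂ :=
  d * q ^ (k ^ 2 + 2 * k) / a ^ (2 * k) * reversedPoch c q k *
    (∏ j ∈ Finset.range k, (d - q ^ j)) * (qPoch (c * q / a) q k)⁻¹ *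
      qPochInf (d / a * q ^ (k + 2)) q

/-- All four terms share the product of d - q^j over j < k, the factor 1/(cq/a;q)_(k+1) and the tail
(dq^(k+3)/a;q)_∞. After these are pulled out a polynomial identity in c, d, q^k and 1/a remains. -/
theorem regTerm_contiguous {a c q : ℂ} (d : ℂ) (hq : ‖q‖ < 1)
    (hca : ∀ m : ℕ, (c * q / a) * q ^ m ≠ 1) (k : ℕ) :
    (1 - d) * regTerm a c d q k - (1 - c * d * q / a) * regTerm a c (d * q) q k =
      regTelescope a c d q (k + 1) - regTelescope a c d q k := by
  have hX : qPochInf (d / a * q ^ (k + 2)) q =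
      (1 - d / a * q ^ (k + 2)) * qPochInf (d / a * q ^ (k + 3)) q := by
    rw [qPochInf_eq_one_sub_mul _ hq, pow_succ q (k + 2), mul_assoc]
  have hP : (qPoch (c * q / a) q k)⁻¹ =
      (qPoch (c * q / a) q (k + 1))⁻¹ * (1 - c * q / a * q ^ k) := by
    have e : 1 - c * q / a * q ^ k ≠ 0 := sub_ne_zero.2 (hca k).symm
    rw [qPoch_succ, mul_inv, mul_assoc, inv_mul_cancel₀ e, mul_one]
  have hT := sub_one_mul_reversedPoch d q k
  rw [regTerm, regTerm, regTelescope, regTelescope, coreTerm, coreTerm, hX, hP, reversedPoch_succ,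
    reversedPoch_mul, Finset.prod_range_succ,
    show d * q / a * q ^ (k + 2) = d / a * q ^ (k + 3) by ring,
    show k + 1 + 2 = k + 3 by ring, show (k + 1) ^ 2 + 2 * (k + 1) = k ^ 2 + 2 * k + (2 * k + 3) by
      ring]
  generalize qPochInf (d / a * q ^ (k + 3)) q = X
  generalize (qPoch (c * q / a) q (k + 1))⁻¹ = P
  generalize (∏ j ∈ Finset.range k, (d - q ^ j)) = T at *
  rw [pow_add, mul_add 2 k 1, pow_add a]
  simp only [div_eq_mul_inv, mul_inv]
  linear_combination (-(reversedPoch c q k * q ^ (k ^ 2 + 2 * k) * (1 - q ^ (2 * k + 2) * a⁻¹) * (a ^ (2 * k))⁻¹ *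
    P * (1 - d * a⁻¹ * q ^ (k + 2)) * X)) * hT

theorem tendsto_regTelescope {a c q : ℂ} (d : ℂ) (ha0 : a ≠ 0) (hq0 : q ≠ 0) (hq : ‖q‖ < 1)
    (hca : ∀ m : ℕ, (c * q / a) * q ^ m ≠ 1) :
    Tendsto (regTelescope a c d q) atTop (𝓝 0) := by
  obtain ⟨M, hM, h⟩ := exists_norm_inv_qPoch_le hq hca
  set R := max ‖c‖ ‖d‖ with hRdef
  have hR : 0 ≤ R := (norm_nonneg c).trans (le_max_left _ _)
  refine squeeze_zero_norm (a := fun k => ‖d‖ * M * Real.exp (‖d / a‖ * (1 - ‖q‖)⁻¹) *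
    (((R + 1) ^ 2 / ‖a‖ ^ 2) ^ k * ‖q‖ ^ (k ^ 2))) (fun k => ?_) ?_
  · have h1 : ‖q ^ (k ^ 2 + 2 * k)‖ ≤ ‖q‖ ^ (k ^ 2) := by
      rw [norm_pow]
      exact pow_le_pow_of_le_one (norm_nonneg _) hq.le (by omega)
    have h2 := norm_reversedPoch_le hq (le_max_left ‖c‖ ‖d‖) k
    have h3 : ‖∏ j ∈ Finset.range k, (d - q ^ j)‖ ≤ (R + 1) ^ k := by
      rw [norm_prod]
      simpa using Finset.prod_le_prod (s := Finset.range k) (fun j _ => norm_nonneg (d - q ^ j))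
        fun j _ => norm_sub_pow_le hq (le_max_right ‖c‖ ‖d‖) j
    have h4 := norm_qPochInf_le_of_norm_le hq (norm_mul_pow_le (d / a) hq (k + 2))
    have h5 := h k
    calc ‖regTelescope a c d q k‖
        = ‖d‖ * ‖q ^ (k ^ 2 + 2 * k)‖ / ‖a‖ ^ (2 * k) * ‖reversedPoch c q k‖ *
          ‖∏ j ∈ Finset.range k, (d - q ^ j)‖ * ‖(qPoch (c * q / a) q k)⁻¹‖ *
          ‖qPochInf (d / a * q ^ (k + 2)) q‖ := by
          simp only [regTelescope, norm_mul, norm_div, norm_pow]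
      _ ≤ ‖d‖ * ‖q‖ ^ (k ^ 2) / ‖a‖ ^ (2 * k) * (R + 1) ^ k * (R + 1) ^ k * M *
          Real.exp (‖d / a‖ * (1 - ‖q‖)⁻¹) := by gcongr
      _ = _ := by rw [div_pow, ← pow_mul, ← pow_mul]; ring
  · simpa using (summable_dominating ha0 hq0 hq hR).tendsto_atTop_zero.const_mul
      (‖d‖ * M * Real.exp (‖d / a‖ * (1 - ‖q‖)⁻¹))

theorem tsum_regTerm_contiguous {a c q : ℂ} (d : ℂ) (ha0 : a ≠ 0) (hq0 : q ≠ 0) (hq : ‖q‖ < 1)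
    (hca : ∀ m : ℕ, (c * q / a) * q ^ m ≠ 1) :
    (1 - d) * ∑' k, regTerm a c d q k =
      (1 - c * d * q / a) * ∑' k, regTerm a c (d * q) q k - d * qPochInf (d * q / a * q) q := by
  have h1 := (((summable_regTerm d ha0 hq0 hq hca).hasSum.mul_left (1 - d)).sub
    ((summable_regTerm (d * q) ha0 hq0 hq hca).hasSum.mul_left
      (1 - c * d * q / a))).tendsto_sum_nat
  have h2 := (tendsto_regTelescope d ha0 hq0 hq hca).sub_const (regTelescope a c d q 0)
  have h3 := tendsto_nhds_unique h1 (h2.congr fun N => by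
    rw [← Finset.sum_range_sub]
    exact (Finset.sum_congr rfl fun k _ => regTerm_contiguous d hq hca k).symm)
  -- The antidifference tends to 0, so only its value at k = 0 survives the telescoping.
  have h4 : regTelescope a c d q 0 = d * qPochInf (d * q / a * q) q := by
    simp [regTelescope, reversedPoch, qPoch_zero,
      show d / a * q ^ 2 = d * q / a * q by ring]
  rw [h4] at h3
  linear_combination h3

/-! ### Vanishing of the defect and evaluation of the ₂φ₁. -/

/-- The defect in the evaluation of `₂φ₁(c, d; a; q, q)`, multiplied by `(dq/a;q)_∞`. -/
noncomputable def phiDefect (a c q d : ℂ) : ℂ :=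
  qPochInf (d * q / a) q * ∑' m, phiTerm a c d q m -
    qPochInf (q / a) q / qPochInf (c * q / a) q * qPochInf (c * d * q / a) q -
    q / a * (qPochInf c q / (qPochInf q q * qPochInf a q)) * qPochInf d q *
      ∑' k, regTerm a c d q k

/-- The product term obeys the homogeneous relation by itself. The inhomogeneous parts of the two
series are both (dq/a) (c;q)_∞ (dq;q)_∞ (dq²/a;q)_∞ / (q,a;q)_∞ once weighted, and cancel. -/
theorem phiDefect_contiguous {a c q : ℂ} (ha0 : a ≠ 0) (hq0 : q ≠ 0) (hq : ‖q‖ < 1)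
    (ha : ∀ m : ℕ, a * q ^ m ≠ 1) (hca : ∀ m : ℕ, (c * q / a) * q ^ m ≠ 1) (d : ℂ) :
    phiDefect a c q d = (1 - c * q / a * d) * phiDefect a c q (d * q) := by
  have h1 := tsum_phiTerm_contiguous (c := c) (d := d) ha0 hq ha
  have h2 := tsum_regTerm_contiguous d ha0 hq0 hq hca
  rw [phiDefect, phiDefect, qPochInf_eq_one_sub_mul (d * q / a) hq,
    qPochInf_eq_one_sub_mul (c * d * q / a) hq, qPochInf_eq_one_sub_mul d hq,
    show d * q * q / a = d * q / a * q by ring,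
    show c * (d * q) * q / a = c * d * q / a * q by ring]
  linear_combination qPochInf (d * q / a * q) q * h1 - q / a *
    (qPochInf c q / (qPochInf q q * qPochInf a q)) * qPochInf (d * q) q * h2

theorem phiDefect_eq_qPoch_mul {a c q : ℂ} (ha0 : a ≠ 0) (hq0 : q ≠ 0) (hq : ‖q‖ < 1)
    (ha : ∀ m : ℕ, a * q ^ m ≠ 1) (hca : ∀ m : ℕ, (c * q / a) * q ^ m ≠ 1) (d : ℂ) (N : ℕ) :
    phiDefect a c q d = qPoch (c * q / a * d) q N * phiDefect a c q (d * q ^ N) := by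
  induction N with
  | zero => simp [qPoch_zero]
  | succ N ih =>
    rw [ih, phiDefect_contiguous ha0 hq0 hq ha hca (d * q ^ N), qPoch_succ, pow_succ,
      mul_assoc d]
    ring

theorem tendsto_phiDefect {a c q : ℂ} (ha0 : a ≠ 0) (hq0 : q ≠ 0) (hq : ‖q‖ < 1)
    (ha : ∀ m : ℕ, a * q ^ m ≠ 1) (hca : ∀ m : ℕ, (c * q / a) * q ^ m ≠ 1) (d : ℂ) :
    Tendsto (fun N : ℕ => phiDefect a c q (d * q ^ N)) atTop (𝓝 (phiDefect a c q 0)) := by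
  have h0 := tendsto_mul_pow_zero d hq
  have h1 : Tendsto (fun N : ℕ => d * q ^ N * q / a) atTop (𝓝 0) := by
    simpa using (h0.mul_const q).div_const a
  have h2 : Tendsto (fun N : ℕ => c * (d * q ^ N) * q / a) atTop (𝓝 0) := by
    simpa using ((h0.const_mul c).mul_const q).div_const a
  have t := tendsto_qPochInf_zero hq
  have h := (((t.comp h1).mul (tendsto_tsum_phiTerm c d hq ha)).sub
    ((t.comp h2).const_mul (qPochInf (q / a) q / qPochInf (c * q / a) q))).sub
    (((t.comp h0).const_mul (q / a * (qPochInf c q / (qPochInf q q * qPochInf a q)))).mul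
      (tendsto_tsum_regTerm d ha0 hq0 hq hca))
  have e : qPochInf 0 q = 1 := by simp [qPochInf]
  simpa only [phiDefect, Function.comp_def, mul_zero, zero_mul, zero_div, e] using h

theorem phiDefect_eq_qPochInf_mul {a c q : ℂ} (ha0 : a ≠ 0) (hq0 : q ≠ 0) (hq : ‖q‖ < 1)
    (ha : ∀ m : ℕ, a * q ^ m ≠ 1) (hca : ∀ m : ℕ, (c * q / a) * q ^ m ≠ 1) (d : ℂ) :
    phiDefect a c q d = qPochInf (c * q / a * d) q * phiDefect a c q 0 := by
  have h := (tendsto_qPoch (c * q / a * d) hq).mul (tendsto_phiDefect ha0 hq0 hq ha hca d)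
  exact tendsto_nhds_unique
    (tendsto_const_nhds.congr fun N => phiDefect_eq_qPoch_mul ha0 hq0 hq ha hca d N) h

/-- At d = 1 the last term contains (1;q)_∞ = 0 and the other two both equal (q/a;q)_∞. Hence 0 =
(cq/a;q)_∞ D(0), which forces D(0) = 0. -/
theorem phiDefect_eq_zero {a c q : ℂ} (ha0 : a ≠ 0) (hq0 : q ≠ 0) (hq : ‖q‖ < 1)
    (ha : ∀ m : ℕ, a * q ^ m ≠ 1) (hca : ∀ m : ℕ, (c * q / a) * q ^ m ≠ 1) (d : ℂ) : phiDefect a c q d = 0 := by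
  have hc := qPochInf_ne_zero hq hca
  have h1 : phiDefect a c q 1 = 0 := by
    rw [phiDefect, tsum_phiTerm_one, qPochInf_one hq, one_mul, mul_one, mul_one,
      div_mul_cancel₀ _ hc]
    ring
  have h2 := phiDefect_eq_qPochInf_mul ha0 hq0 hq ha hca 1
  rw [h1, mul_one] at h2
  rw [phiDefect_eq_qPochInf_mul ha0 hq0 hq ha hca d,
    (mul_eq_zero.1 h2.symm).resolve_left hc, mul_zero]

theorem regTerm_eq_mul {a c d q : ℂ} (hq : ‖q‖ < 1) (hda : ∀ m : ℕ, (d * q / a) * q ^ m ≠ 1)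
    (k : ℕ) :
    regTerm a c d q k = qPochInf (d * q / a) q * (coreTerm a c d q k /
      (qPoch (c * q / a) q (k + 1) * qPoch (d * q / a) q (k + 1))) := by
  have h := qPoch_ne_zero hda (k + 1)
  rw [qPochInf_eq_qPoch_mul (d * q / a) hq (k + 1), regTerm,
    show d * q / a * q ^ (k + 1) = d / a * q ^ (k + 2) by ring]
  generalize qPoch (d * q / a) q (k + 1) = y at *
  field_simp

/-- Since q^(1-n)/x = q/(xq^n), the powers (cd)^k q^(2nk) turn the two shifted factorials into
polynomials. The inner series at n is thus the one at n = 0 with c, d replaced by cq^n, dq^n. -/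
theorem innerTerm_eq {a c d q : ℂ} (hq0 : q ≠ 0) (hc0 : c ≠ 0) (hd0 : d ≠ 0) (n k : ℕ) :
    innerTerm a c d q n k = coreTerm a (c * q ^ n) (d * q ^ n) q k /
      (qPoch (c * q ^ n * q / a) q (k + 1) * qPoch (d * q ^ n * q / a) q (k + 1)) := by
  have hqn : q ^ n ≠ 0 := pow_ne_zero _ hq0
  have hz : ∀ x : ℂ, q ^ (1 - (n : ℤ)) / x = q / (x * q ^ n) := fun x => by
    rw [zpow_sub₀ hq0, zpow_one, zpow_natCast, div_div, mul_comm]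
  rw [innerTerm, coreTerm, ← pow_mul_qPoch_div (mul_ne_zero hc0 hqn),
    ← pow_mul_qPoch_div (mul_ne_zero hd0 hqn), hz, hz,
    show c * q ^ n * q / a = c * q ^ (n + 1) / a by ring,
    show d * q ^ n * q / a = d * q ^ (n + 1) / a by ring,
    show k ^ 2 + 2 * n * k + 2 * k = k ^ 2 + 2 * k + 2 * (n * k) by ring, pow_add q _ (2 * (n * k)),
    mul_pow, mul_pow, div_pow, mul_pow, ← pow_mul, ← pow_mul]
  ring

theorem tsum_phiTerm_eq {a c d q : ℂ} (ha0 : a ≠ 0) (hq0 : q ≠ 0) (hq : ‖q‖ < 1)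
    (ha : ∀ m : ℕ, a * q ^ m ≠ 1) (hca : ∀ m : ℕ, (c * q / a) * q ^ m ≠ 1)
    (hda : ∀ m : ℕ, (d * q / a) * q ^ m ≠ 1) :
    ∑' m, phiTerm a c d q m =
      qPochInf (q / a) q * qPochInf (c * d * q / a) q /
          (qPochInf (c * q / a) q * qPochInf (d * q / a) q) +
        q / a * (qPochInf c q * qPochInf d q / (qPochInf q q * qPochInf a q)) *
          ∑' k, coreTerm a c d q k /
            (qPoch (c * q / a) q (k + 1) * qPoch (d * q / a) q (k + 1)) := by
  have h := phiDefect_eq_zero ha0 hq0 hq ha hca d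
  have e := qPochInf_ne_zero hq hda
  rw [phiDefect, tsum_congr (regTerm_eq_mul hq hda), tsum_mul_left] at h
  refine mul_left_cancel₀ e ?_
  have e' : qPochInf (q / a) q * qPochInf (c * d * q / a) q /
      (qPochInf (c * q / a) q * qPochInf (d * q / a) q) =
      qPochInf (q / a) q / qPochInf (c * q / a) q * qPochInf (c * d * q / a) q *
        (qPochInf (d * q / a) q)⁻¹ := by
    rw [div_eq_mul_inv, mul_inv]
    ring
  rw [e', mul_add, mul_left_comm, mul_inv_cancel₀ e]
  linear_combination h

/-! ### Absolute convergence of the series on the right-hand side. -/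

theorem exists_norm_innerTerm_le {a c d q : ℂ} (hq0 : q ≠ 0) (hq : ‖q‖ < 1)
    (hc0 : c ≠ 0) (hd0 : d ≠ 0) (hca : ∀ m : ℕ, (c * q / a) * q ^ m ≠ 1)
    (hda : ∀ m : ℕ, (d * q / a) * q ^ m ≠ 1) :
    ∃ M : ℝ, 0 ≤ M ∧ ∀ n k, ‖innerTerm a c d q n k‖ ≤
      M * (((max ‖c‖ ‖d‖ + 1) ^ 2 / ‖a‖ ^ 2) ^ k * ‖q‖ ^ (k ^ 2)) := by
  have key : ∀ x : ℂ, (∀ m : ℕ, (x * q / a) * q ^ m ≠ 1) → ∃ M : ℝ, 0 ≤ M ∧ ∀ n k,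
      ‖(qPoch (x * q ^ n * q / a) q (k + 1))⁻¹‖ ≤ M := by
    intro x hx
    obtain ⟨M, hM, h⟩ := exists_norm_inv_qPoch_le hq hx
    refine ⟨Real.exp (‖x * q / a‖ * (1 - ‖q‖)⁻¹) * M, by positivity, fun n k => ?_⟩
    -- Writing the reciprocal of the shifted factorial as a quotient with fixed base xq/a makes the
    -- bound independent of n.
    have e : (qPoch (x * q ^ n * q / a) q (k + 1))⁻¹ =
        qPoch (x * q / a) q n * (qPoch (x * q / a) q (n + (k + 1)))⁻¹ := by
      have := qPoch_ne_zero hx n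
      rw [qPoch_add _ _ n, mul_inv, mul_inv_cancel_left₀ this,
        show x * q ^ n * q / a = x * q / a * q ^ n by ring]
    rw [e, norm_mul]
    gcongr
    exacts [norm_qPoch_le _ hq n, h _]
  obtain ⟨M₁, hM₁, h₁⟩ := key c hca
  obtain ⟨M₂, hM₂, h₂⟩ := key d hda
  refine ⟨(1 + ‖a‖⁻¹) * (M₁ * M₂), by positivity, fun n k => ?_⟩
  have h3 := norm_coreTerm_le (a := a) hq ((norm_mul_pow_le c hq n).trans (le_max_left _ ‖d‖))
    ((norm_mul_pow_le d hq n).trans (le_max_right ‖c‖ _)) k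
  rw [innerTerm_eq hq0 hc0 hd0, div_eq_mul_inv, mul_inv, norm_mul, norm_mul,
    mul_right_comm (1 + ‖a‖⁻¹)]
  gcongr
  exacts [h₁ n k, h₂ n k]

/-- The base ‖b‖ + 1 stays positive at b = 0, as `summable_pow_mul_pow_sq` requires. -/
theorem exists_norm_pow_mul_div_le {b q : ℂ} (hq : ‖q‖ < 1) (hb : ∀ m : ℕ, b * q ^ m ≠ 1) :
    ∃ M : ℝ, 0 ≤ M ∧ ∀ n, ‖b ^ n * q ^ (n ^ 2) / (qPoch q q n * qPoch b q n)‖ ≤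
      M * ((‖b‖ + 1) ^ n * ‖q‖ ^ (n ^ 2)) := by
  obtain ⟨M₁, hM₁, h₁⟩ := exists_norm_inv_qPoch_le hq (self_mul_pow_ne_one hq)
  obtain ⟨M₂, hM₂, h₂⟩ := exists_norm_inv_qPoch_le hq hb
  refine ⟨M₁ * M₂, by positivity, fun n => ?_⟩
  rw [div_eq_mul_inv, mul_inv, norm_mul, norm_mul, norm_mul, norm_pow, norm_pow, mul_comm]
  gcongr
  exacts [h₁ n, h₂ n, by linarith]

theorem summable_pow_mul_div_mul {b q : ℂ} (hq0 : q ≠ 0) (hq : ‖q‖ < 1)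
    (hb : ∀ m : ℕ, b * q ^ m ≠ 1) {f : ℕ → ℂ} {M : ℝ} (hf : ∀ n, ‖f n‖ ≤ M) :
    Summable fun n : ℕ => b ^ n * q ^ (n ^ 2) / (qPoch q q n * qPoch b q n) * f n := by
  obtain ⟨M', hM', h⟩ := exists_norm_pow_mul_div_le hq hb
  refine .of_norm_bounded (((summable_pow_mul_pow_sq (K := ‖b‖ + 1) (by positivity)
    (norm_pos_iff.2 hq0) hq).mul_left M').mul_right M) fun n => ?_
  rw [norm_mul]
  gcongr
  exacts [h n, hf n]

theorem summable_outerTerm {a b c d q : ℂ} (ha0 : a ≠ 0) (hq0 : q ≠ 0) (hq : ‖q‖ < 1)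
    (hc0 : c ≠ 0) (hd0 : d ≠ 0) (hb : ∀ m : ℕ, b * q ^ m ≠ 1)
    (hca : ∀ m : ℕ, (c * q / a) * q ^ m ≠ 1) (hda : ∀ m : ℕ, (d * q / a) * q ^ m ≠ 1) :
    Summable (outerTerm a b c d q) := by
  obtain ⟨M, hM, h⟩ := exists_norm_innerTerm_le hq0 hq hc0 hd0 hca hda
  have hs := (summable_dominating (R := max ‖c‖ ‖d‖) ha0 hq0 hq (by positivity)).mul_left M
  exact summable_pow_mul_div_mul hq0 hq hb fun n => tsum_of_norm_bounded hs.hasSum (h n)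

theorem firstTerm_eq (a b c d q : ℂ) (n : ℕ) :
    firstTerm a b c d q n = b ^ n * q ^ (n ^ 2) / (qPoch q q n * qPoch b q n) *
      (qPoch c q n * qPoch d q n * qPoch (c * q / a) q n * qPoch (d * q / a) q n *
        (qPoch (c * d * q / a) q (2 * n))⁻¹) := by
  rw [firstTerm, div_eq_mul_inv, div_eq_mul_inv, mul_inv _ (qPoch (c * d * q / a) q (2 * n))]
  ring

theorem summable_firstTerm {a b c d q : ℂ} (hq0 : q ≠ 0) (hq : ‖q‖ < 1)
    (hb : ∀ m : ℕ, b * q ^ m ≠ 1) (hcda : ∀ m : ℕ, (c * d * q / a) * q ^ m ≠ 1) :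
    Summable (firstTerm a b c d q) := by
  obtain ⟨M, hM, h⟩ := exists_norm_inv_qPoch_le hq hcda
  simp only [funext (firstTerm_eq a b c d q)]
  let B : ℂ → ℝ := fun x => Real.exp (‖x‖ * (1 - ‖q‖)⁻¹)
  refine summable_pow_mul_div_mul hq0 hq hb
    (M := B c * B d * B (c * q / a) * B (d * q / a) * M) fun n => ?_
  simp only [norm_mul]
  gcongr
  exacts [norm_qPoch_le _ hq n, norm_qPoch_le _ hq n, norm_qPoch_le _ hq n,
    norm_qPoch_le _ hq n, h _]

/-! ### The double series and the two orders of summation. -/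

/-- The summand of the double series obtained from the left-hand side. -/
noncomputable def doubleTerm (a b c d q : ℂ) (p : ℕ × ℕ) : ℂ :=
  b ^ p.1 * q ^ (p.1 ^ 2) / (qPoch q q p.1 * qPoch b q p.1) *
    (qPoch c q p.1 * qPoch d q p.1 * phiTerm a (c * q ^ p.1) (d * q ^ p.1) q p.2)

theorem summable_doubleTerm {a b : ℂ} (c d : ℂ) {q : ℂ} (hq0 : q ≠ 0) (hq : ‖q‖ < 1)
    (ha : ∀ m : ℕ, a * q ^ m ≠ 1) (hb : ∀ m : ℕ, b * q ^ m ≠ 1) :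
    Summable (doubleTerm a b c d q) := by
  obtain ⟨M₁, hM₁, h₁⟩ := exists_norm_pow_mul_div_le hq hb
  obtain ⟨M₂, hM₂, h₂⟩ := exists_norm_phiTerm_le (max ‖c‖ ‖d‖) hq ha
  have s₁ := summable_pow_mul_pow_sq (K := ‖b‖ + 1) (by positivity) (norm_pos_iff.2 hq0) hq
  have s₂ := summable_geometric_of_lt_one (norm_nonneg q) hq
  let B : ℂ → ℝ := fun x => Real.exp (‖x‖ * (1 - ‖q‖)⁻¹)
  have s := ((s₁.mul_left M₁).mul_right (B c * B d)).mul_of_nonneg (s₂.mul_left M₂)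
    (fun _ => by positivity) (fun _ => by positivity)
  refine .of_norm_bounded s fun p => ?_
  rw [doubleTerm, norm_mul, norm_mul _ (phiTerm _ _ _ _ _), norm_mul (qPoch c q p.1), ← mul_assoc]
  gcongr
  exacts [h₁ _, norm_qPoch_le _ hq _, norm_qPoch_le _ hq _,
    h₂ _ _ ((norm_mul_pow_le c hq _).trans (le_max_left _ _))
      ((norm_mul_pow_le d hq _).trans (le_max_right _ _)) _]

theorem lhsTerm_eq_sum_antidiagonal {a b : ℂ} (c d : ℂ) {q : ℂ} (hq0 : q ≠ 0) (hq : ‖q‖ < 1)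
    (ha : ∀ m : ℕ, a * q ^ m ≠ 1) (hb : ∀ m : ℕ, b * q ^ m ≠ 1) (n : ℕ) :
    lhsTerm a b c d q n =
      ∑ p ∈ Finset.HasAntidiagonal.antidiagonal n, doubleTerm a b c d q p := by
  rw [lhsTerm, mul_assoc, mul_div_assoc, qPoch_div_eq_sum_antidiagonal hq0 hq ha hb,
    Finset.mul_sum]
  refine Finset.sum_congr rfl fun p hp => ?_
  obtain rfl := Finset.HasAntidiagonal.mem_antidiagonal.1 hp
  rw [doubleTerm, phiTerm, qPoch_add, qPoch_add]
  ring

theorem hasSum_lhsTerm {a b : ℂ} (c d : ℂ) {q : ℂ} (hq0 : q ≠ 0) (hq : ‖q‖ < 1)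
    (ha : ∀ m : ℕ, a * q ^ m ≠ 1) (hb : ∀ m : ℕ, b * q ^ m ≠ 1) :
    HasSum (lhsTerm a b c d q) (∑' p, doubleTerm a b c d q p) := by
  have hs := summable_doubleTerm c d hq0 hq ha hb
  rw [funext (lhsTerm_eq_sum_antidiagonal c d hq0 hq ha hb)]
  -- Regrouping the summable double series along antidiagonals gives both the convergence of the
  -- left-hand side and its sum.
  simp only [← Finset.sum_coe_sort (Finset.HasAntidiagonal.antidiagonal _)]
  exact (Finset.HasAntidiagonal.sigmaAntidiagonalEquivProd.hasSum_iff.2 hs.hasSum).sigma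
    fun n => hasSum_fintype _

theorem tsum_doubleTerm_right {a b c d q : ℂ} (ha0 : a ≠ 0) (hq0 : q ≠ 0) (hq : ‖q‖ < 1)
    (hc0 : c ≠ 0) (hd0 : d ≠ 0) (ha : ∀ m : ℕ, a * q ^ m ≠ 1)
    (hca : ∀ m : ℕ, (c * q / a) * q ^ m ≠ 1) (hda : ∀ m : ℕ, (d * q / a) * q ^ m ≠ 1)
    (hcda : ∀ m : ℕ, (c * d * q / a) * q ^ m ≠ 1) (n : ℕ) :
    ∑' m, doubleTerm a b c d q (n, m) =
      qPochInf (q / a) q * qPochInf (c * d * q / a) q /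
          (qPochInf (c * q / a) q * qPochInf (d * q / a) q) * firstTerm a b c d q n +
        q / a * (qPochInf c q * qPochInf d q / (qPochInf q q * qPochInf a q)) *
          outerTerm a b c d q n := by
  have hs : ∀ x : ℂ, x * q ^ n * q / a = x * q / a * q ^ n := fun x => by ring
  have h := tsum_phiTerm_eq (c := c * q ^ n) (d := d * q ^ n) ha0 hq0 hq ha
    (by rw [hs]; exact mul_pow_shift_ne_one hca n) (by rw [hs]; exact mul_pow_shift_ne_one hda n)
  rw [← tsum_congr (innerTerm_eq hq0 hc0 hd0 n), hs, hs,
    show c * q ^ n * (d * q ^ n) * q / a = c * d * q / a * q ^ (2 * n) by ring] at h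
  simp only [doubleTerm]
  rw [tsum_mul_left, tsum_mul_left, h, firstTerm_eq, outerTerm,
    qPochInf_eq_qPoch_mul c hq n, qPochInf_eq_qPoch_mul d hq n,
    qPochInf_eq_qPoch_mul (c * q / a) hq n, qPochInf_eq_qPoch_mul (d * q / a) hq n,
    qPochInf_eq_qPoch_mul (c * d * q / a) hq (2 * n)]
  have e1 := qPoch_ne_zero hca n
  have e2 := qPoch_ne_zero hda n
  have e3 := qPoch_ne_zero hcda (2 * n)
  have e4 := qPochInf_ne_zero hq (mul_pow_shift_ne_one hca n)
  have e5 := qPochInf_ne_zero hq (mul_pow_shift_ne_one hda n)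
  -- Here u, v, w stand for the finite factors (cq/a;q)_n, (dq/a;q)_n, (cdq/a;q)_(2n), and s, t, z
  -- for the corresponding infinite tails. The finite factors in `firstTerm` cancel those split off
  -- from the infinite products.
  have e6 : ∀ x₁ x₂ y z u v w s t : ℂ, s ≠ 0 → t ≠ 0 → u ≠ 0 → v ≠ 0 → w ≠ 0 →
      x₁ * x₂ * (y * z / (s * t)) =
        y * (w * z) / (u * s * (v * t)) * (x₁ * x₂ * u * v * w⁻¹) := by
    intro x₁ x₂ y z u v w s t hs ht hu hv hw
    field_simp
  rw [mul_add, e6 _ _ _ _ _ _ _ _ _ e4 e5 e1 e2 e3]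
  ring

theorem theorem1p1 (a b c d q : ℂ)
    (hq0 : q ≠ 0) (hq1 : ‖q‖ < 1)
    (ha0 : a ≠ 0) (hc0 : c ≠ 0) (hd0 : d ≠ 0)
    (ha : ∀ m : ℕ, a * q ^ m ≠ 1)
    (hb : ∀ m : ℕ, b * q ^ m ≠ 1)
    (hca : ∀ m : ℕ, (c * q / a) * q ^ m ≠ 1)
    (hda : ∀ m : ℕ, (d * q / a) * q ^ m ≠ 1)
    (hcda : ∀ m : ℕ, (c * d * q / a) * q ^ m ≠ 1) :
    Summable (lhsTerm a b c d q) ∧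
    Summable (firstTerm a b c d q) ∧
    (∀ n : ℕ, Summable (innerTerm a c d q n)) ∧
    Summable (outerTerm a b c d q) ∧
    (∑' n : ℕ, lhsTerm a b c d q n) =
      qPochInf (q / a) q * qPochInf (c * d * q / a) q /
          (qPochInf (c * q / a) q * qPochInf (d * q / a) q) *
          (∑' n : ℕ, firstTerm a b c d q n) +
        q / a * (qPochInf c q * qPochInf d q / (qPochInf q q * qPochInf a q)) *
          (∑' n : ℕ, outerTerm a b c d q n) := by
  have hL := hasSum_lhsTerm c d hq0 hq1 ha hb
  have hF : Summable (firstTerm a b c d q) := summable_firstTerm hq0 hq1 hb hcda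
  have hO := summable_outerTerm ha0 hq0 hq1 hc0 hd0 hb hca hda
  obtain ⟨M, -, hI⟩ := exists_norm_innerTerm_le hq0 hq1 hc0 hd0 hca hda
  refine ⟨hL.summable, hF, fun n => .of_norm_bounded
    ((summable_dominating ha0 hq0 hq1 (by positivity)).mul_left M) (hI n), hO, ?_⟩
  rw [hL.tsum_eq, (summable_doubleTerm c d hq0 hq1 ha hb).tsum_prod,
    tsum_congr (tsum_doubleTerm_right ha0 hq0 hq1 hc0 hd0 ha hca hda hcda),
    (hF.mul_left _).tsum_add (hO.mul_left _), tsum_mul_left, tsum_mul_left]
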